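/- Work over $\mathbb{C}$. A reduced plane curve $C\subset\mathbb{P}^2$ is \emph{Cr-contractible} if there is a Cremona transformation, i.e. a birational map $\gamma\colon\mathbb{P}^2\dasharrow\mathbb{P}^2$, which contracts $C$ to a set of points, that is, $\gamma$ is constant on every irreducible component of $C$. A union $C$ of $d$ distinct lines in $\mathbb{P}^2$ is said to be of type $(d;m_0,m_1,\ldots,m_r)$ if there are distinct points $P_0,\ldots,P_r\in\mathbb{P}^2$ such that $C$ has multiplicity exactly $m_i$ at $P_i$ for $0\le i\le r$ and has multiplicity at most $1$ at every other point; exponents denote repeated multiplicities. Proposition. Let $d\ge 2$. Every union $C$ of $d$ distinct lines in $\mathbb{P}^2$ of type $(d;d-2,2^{2d-3})$ (i.e. $C$ has a point $P_0$ of multiplicity exactly $d-2$, exactly $2d-3$ further points of multiplicity $2$, and multiplicity at most $1$ at all other points) is Cr-contractible. -/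

import Mathlib

open scoped LinearAlgebra.Projectivization

noncomputable section

namespace PlaneCremona

/-- Polynomials in three variables over the complex numbers. -/
abbrev Form : Type := MvPolynomial (Fin 3) ℂ

/-- The complex projective plane. -/
abbrev Plane : Type := ℙ ℂ (Fin 3 → ℂ)

/-- A reduced plane curve, given by a squarefree form. (Squarefree implies nonzero.) -/
structure PlaneCurve where
  /-- the degree of the curve -/
  degree : ℕ
  /-- an equation of the curve -/
  form : Form
  isHomogeneous : form.IsHomogeneous degree
  squarefree : Squarefree form

/-- The order of vanishing of the polynomial `F` at the vector `v`: the order at the origin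
of the translate `F (v + X)`. -/
def orderAt (F : Form) (v : Fin 3 → ℂ) : ℕ∞ :=
  MvPowerSeries.order
    ((MvPolynomial.aeval (fun i => MvPolynomial.C (v i) + MvPolynomial.X i) F : Form) :
      MvPowerSeries (Fin 3) ℂ)

/-- The multiplicity of a plane curve at a point. As the equation is homogeneous, its order of
vanishing is constant along the line in `ℂ³` minus the origin that the point represents, and
equals the order at the point of the equation in any affine chart. -/
def PlaneCurve.multiplicity (C : PlaneCurve) (p : Plane) : ℕ∞ :=
  orderAt C.form p.rep

/-- The curve is a union of lines. The lines are distinct, since the equation is squarefree. -/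
def PlaneCurve.IsUnionOfLines (C : PlaneCurve) : Prop :=
  ∃ L : Fin C.degree → Form, (∀ i, (L i).IsHomogeneous 1) ∧ C.form = ∏ i, L i

/-- `C` is a reduced union of lines of type `(d; m₀, …, mᵣ)`: it has degree `d` and exact
multiplicities `m₀, …, mᵣ` at distinct points `P₀, …, Pᵣ`, and no other singular point.
(The singular points of a union of lines are ordinary, so there are no infinitely near ones:
after blowing up a point, the lines through it are separated.) -/
def PlaneCurve.IsUnionOfLinesOfType (C : PlaneCurve) (d : ℕ) (m : List ℕ) : Prop :=
  C.IsUnionOfLines ∧ C.degree = d ∧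
    ∃ P : Fin m.length → Plane, Function.Injective P ∧
      (∀ i, C.multiplicity (P i) = (m.get i : ℕ∞)) ∧
      ∀ Q : Plane, Q ∉ Set.range P → C.multiplicity Q ≤ 1

/-- A rational map from the plane to itself, given by three forms of the same degree without
common factor (in particular, not all zero). -/
structure PlaneRationalMap where
  /-- the common degree of the components -/
  degree : ℕ
  /-- the homogeneous components -/
  coords : Fin 3 → Form
  isHomogeneous : ∀ i, (coords i).IsHomogeneous degree
  coprime : ∀ g : Form, (∀ i, g ∣ coords i) → IsUnit g

/-- The composition `ψ ∘ φ` is defined and is the identity, as a rational map. -/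
def PlaneRationalMap.IsLeftInverse (ψ φ : PlaneRationalMap) : Prop :=
  ∃ H : Form, H ≠ 0 ∧
    ∀ i, MvPolynomial.aeval φ.coords (ψ.coords i) = H * MvPolynomial.X i

/-- Cremona transformations: the birational maps from the plane to itself. -/
def PlaneRationalMap.IsCremona (φ : PlaneRationalMap) : Prop :=
  ∃ ψ : PlaneRationalMap, ψ.IsLeftInverse φ ∧ φ.IsLeftInverse ψ

/-- The values of the components of `φ` at a vector. -/
def PlaneRationalMap.evalAt (φ : PlaneRationalMap) (v : Fin 3 → ℂ) : Fin 3 → ℂ :=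
  fun i => MvPolynomial.eval v (φ.coords i)

/-- `φ` is constant on the irreducible curve with equation `g`: all points of the curve at which
`φ` is defined have the same image. As the components of `φ` have no common factor, `φ` is
defined exactly where they do not all vanish, hence at all but finitely many points of the
curve. -/
def PlaneRationalMap.IsConstantOn (φ : PlaneRationalMap) (g : Form) : Prop :=
  ∃ q : Plane, ∀ p : Plane, MvPolynomial.eval p.rep g = 0 →
    ∀ h : φ.evalAt p.rep ≠ 0, Projectivization.mk ℂ (φ.evalAt p.rep) h = q

/-- `C` is Cremona contractible: some Cremona transformation contracts `C` to a set of points,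
that is, it is constant on every irreducible component of `C`. -/
def PlaneCurve.IsCrContractible (C : PlaneCurve) : Prop :=
  ∃ φ : PlaneRationalMap, φ.IsCremona ∧
    ∀ g : Form, Irreducible g → g ∣ C.form → φ.IsConstantOn g

end PlaneCremona

end

open scoped LinearAlgebra.Projectivization Matrix

noncomputable section

namespace PlaneCremona

open MvPolynomial

/-! Exactly two of the lines, `u` and `v`, miss `P₀`, and their intersection `q` lies on none of the
others, since no point except `P₀` lies on three lines. Coordinates can be chosen with `u : x = 0`,
`v : y = 0`, `P₀ = [1 : 1 : 0]`, `q = [0 : 0 : 1]`. A line through `P₀` but not `q` is then `z = a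
(x - y)`, i.e. a fibre `t = a` of the pencil `t = z / (x - y)`. With `s = x / y`, the function `u =
s * ∏ (t - a i)` is zero on `x = 0` and on these fibres and infinite on `y = 0`, while `(t, u)`
still generates the function field. The map `[1 : t * u ^ 2 : u]` thus sends the zeros of `u` to `[1
: 0 : 0]` and its pole `y = 0` to `[0 : 1 : 0]`. `exists_isCremona_isConstantOn` carries this back
to the given lines. -/

/-! ### Linear forms and linear substitutions -/

/-- The linear form with coefficient vector `c`. -/
def linForm (c : Fin 3 → ℂ) : Form := ∑ j, C (c j) * X j

lemma isHomogeneous_linForm (c : Fin 3 → ℂ) : (linForm c).IsHomogeneous 1 :=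
  IsHomogeneous.sum _ _ _ fun _ _ => isHomogeneous_C_mul_X _ _

lemma exists_eq_linForm {L : Form} (hL : L.IsHomogeneous 1) : ∃ c, L = linForm c := by
  rw [← mem_homogeneousSubmodule, homogeneousSubmodule_one_eq_span_X,
    Submodule.mem_span_range_iff_exists_fun] at hL
  obtain ⟨c, rfl⟩ := hL
  exact ⟨c, by simp [linForm, smul_eq_C_mul]⟩

lemma aeval_linForm {A : Type*} [CommRing A] [Algebra ℂ A] (f : Fin 3 → A) (c : Fin 3 → ℂ) :
    aeval f (linForm c) = ∑ j, algebraMap ℂ A (c j) * f j := by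
  simp [linForm]

lemma eval_linForm (v c : Fin 3 → ℂ) : eval v (linForm c) = c ⬝ᵥ v := by
  simp [linForm, dotProduct]

lemma coeff_single_linForm (c : Fin 3 → ℂ) (j : Fin 3) :
    coeff (Finsupp.single j 1) (linForm c) = c j := by
  simp [linForm, coeff_sum, coeff_C_mul, coeff_X, Finsupp.single_left_inj]

lemma linForm_smul (a : ℂ) (c : Fin 3 → ℂ) : linForm (a • c) = C a * linForm c := by
  simp [linForm, Finset.mul_sum, mul_assoc]

/-- The linear substitution given by the rows of a matrix. -/
def linSubst (M : Matrix (Fin 3) (Fin 3) ℂ) : Form →ₐ[ℂ] Form := aeval fun i => linForm (M i)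

lemma linSubst_linForm (M : Matrix (Fin 3) (Fin 3) ℂ) (c : Fin 3 → ℂ) :
    linSubst M (linForm c) = linForm (Matrix.vecMul c M) := by
  rw [linSubst, aeval_linForm]
  simp only [linForm, Matrix.vecMul, dotProduct, map_sum, map_mul,
    Finset.sum_mul, Finset.mul_sum, algebraMap_eq, mul_assoc]
  exact Finset.sum_comm

lemma linForm_one_row (i : Fin 3) : linForm ((1 : Matrix (Fin 3) (Fin 3) ℂ) i) = X i := by
  simp [linForm, Matrix.one_apply]

lemma linSubst_linSubst {M N : Matrix (Fin 3) (Fin 3) ℂ} (h : N * M = 1) (F : Form) :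
    linSubst M (linSubst N F) = F := by
  have : (linSubst M).comp (linSubst N) = AlgHom.id ℂ Form := by
    ext1 i
    rw [AlgHom.comp_apply, linSubst, linSubst, aeval_X, ← linSubst, linSubst_linForm]
    have : Matrix.vecMul (N i) M = (1 : Matrix (Fin 3) (Fin 3) ℂ) i := by rw [← h]; rfl
    rw [this, linForm_one_row]; rfl
  exact DFunLike.congr_fun this F

/-! ### Multiplicities of unions of lines -/

lemma orderAt_prod {ι : Type*} (s : Finset ι) (L : ι → Form) (v : Fin 3 → ℂ) :
    orderAt (∏ i ∈ s, L i) v = ∑ i ∈ s, orderAt (L i) v := by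
  simp only [orderAt, map_prod, ← MvPowerSeries.order_prod]
  congr 1
  exact map_prod (coeToMvPowerSeries.ringHom (σ := Fin 3) (R := ℂ)) _ _

/-- Translation by `v` only adds the constant term `c ⬝ᵥ v`; the linear part stays `linForm c`. -/
lemma orderAt_linForm {c : Fin 3 → ℂ} (hc : c ≠ 0) (v : Fin 3 → ℂ) :
    orderAt (linForm c) v = if c ⬝ᵥ v = 0 then 1 else 0 := by
  have hsub : (aeval (fun i => C (v i) + X i) (linForm c) : Form)
      = C (c ⬝ᵥ v) + linForm c := by
    rw [aeval_linForm]
    simp [linForm, dotProduct, mul_add, Finset.sum_add_distrib]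
  have hcc : MvPowerSeries.constantCoeff
      ((C (c ⬝ᵥ v) + linForm c : Form) : MvPowerSeries (Fin 3) ℂ) = c ⬝ᵥ v := by
    rw [← MvPowerSeries.coeff_zero_eq_constantCoeff_apply, coeff_coe]
    simp [linForm, coeff_sum]
  rw [orderAt, hsub]
  split_ifs with h
  · apply le_antisymm
    · obtain ⟨j, hj⟩ := Function.ne_iff.1 hc
      have := MvPowerSeries.order_le (d := Finsupp.single j 1)
        (f := ((C (c ⬝ᵥ v) + linForm c : Form) : MvPowerSeries (Fin 3) ℂ))
        (by rw [coeff_coe, h, map_zero, zero_add, coeff_single_linForm]; exact hj)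
      simpa using this
    · rw [MvPowerSeries.one_le_order_iff_constCoeff_eq_zero, hcc, h]
  · by_contra h0
    exact h (hcc ▸ MvPowerSeries.order_ne_zero_iff_constCoeff_eq_zero.1 h0)

/-- The multiplicity of a union of lines at a point is the number of lines through it. -/
lemma orderAt_prod_linForm {ι : Type*} (s : Finset ι) {c : ι → Fin 3 → ℂ} (hc : ∀ i ∈ s, c i ≠ 0)
    (v : Fin 3 → ℂ) :
    orderAt (∏ i ∈ s, linForm (c i)) v = ((s.filter fun i => c i ⬝ᵥ v = 0).card : ℕ∞) := by
  rw [orderAt_prod, Finset.sum_congr rfl fun i hi => orderAt_linForm (hc i hi) v,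
    Finset.sum_boole]

/-! ### Rational maps under linear changes of coordinates -/

lemma PlaneRationalMap.coprime_of_isRelPrime {f : Fin 3 → Form} {i j : Fin 3}
    (h : IsRelPrime (f i) (f j)) (g : Form) (hg : ∀ i, g ∣ f i) : IsUnit g :=
  h (hg i) (hg j)

/-- The composition of a rational map with an invertible linear substitution at the source. -/
def PlaneRationalMap.precomp (φ : PlaneRationalMap) {M N : Matrix (Fin 3) (Fin 3) ℂ}
    (h : M * N = 1) : PlaneRationalMap where
  degree := φ.degree
  coords i := linSubst M (φ.coords i)
  isHomogeneous i := by
    have := (φ.isHomogeneous i).aeval (fun i => linForm (M i))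
      (fun i => isHomogeneous_linForm (M i))
    rwa [one_mul] at this
  coprime g hg := by
    have h1 : IsUnit (linSubst N g) := φ.coprime _ fun i => by
      have := map_dvd (linSubst N) (hg i)
      rwa [linSubst_linSubst h] at this
    have := h1.map (linSubst M)
    rwa [linSubst_linSubst (mul_eq_one_comm.1 h)] at this

/-- The composition of an invertible linear map of the plane with a rational map. -/
def PlaneRationalMap.postcomp (φ : PlaneRationalMap) {M N : Matrix (Fin 3) (Fin 3) ℂ}
    (h : M * N = 1) : PlaneRationalMap where
  degree := φ.degree
  coords i := ∑ j, C (M i j) * φ.coords j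
  isHomogeneous i := IsHomogeneous.sum _ _ _ fun j _ => (φ.isHomogeneous j).C_mul _
  coprime g hg := φ.coprime g fun i => by
    have h1 : φ.coords i = ∑ j, C (N i j) * ∑ k, C (M j k) * φ.coords k := by
      simp_rw [Finset.mul_sum, ← mul_assoc, ← C_mul]
      rw [Finset.sum_comm]
      simp_rw [← Finset.sum_mul, ← map_sum, ← Matrix.mul_apply, mul_eq_one_comm.1 h]
      simp [Matrix.one_apply]
    rw [h1]
    exact Finset.dvd_sum fun j _ => (hg j).mul_left _

/-- The inverse is `ψ` followed by the inverse matrix `N`. -/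
lemma PlaneRationalMap.IsCremona.precomp {φ : PlaneRationalMap} (hφ : φ.IsCremona)
    {M N : Matrix (Fin 3) (Fin 3) ℂ} (h : M * N = 1) : (φ.precomp h).IsCremona := by
  obtain ⟨ψ, ⟨H, hH, hψφ⟩, ⟨K, hK, hφψ⟩⟩ := hφ
  have h' := mul_eq_one_comm.1 h
  refine ⟨ψ.postcomp h', ⟨linSubst M H, ?_, fun i => ?_⟩, ⟨K, hK, fun i => ?_⟩⟩
  · intro h0
    exact hH (by rw [← linSubst_linSubst h H, h0, map_zero])
  · have e : aeval (φ.precomp h).coords = (linSubst M).comp (aeval φ.coords) := by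
      ext1 i; simp [PlaneRationalMap.precomp]
    rw [e]
    have e2 : aeval φ.coords ((ψ.postcomp h').coords i) = H * linForm (N i) := by
      simp only [PlaneRationalMap.postcomp, map_sum, map_mul, hψφ, linForm, Finset.mul_sum,
        mul_left_comm, algHom_C, algebraMap_eq]
    rw [AlgHom.comp_apply, e2, map_mul, linSubst_linForm]
    have : Matrix.vecMul (N i) M = (1 : Matrix (Fin 3) (Fin 3) ℂ) i := by rw [← h']; rfl
    rw [this, linForm_one_row]
  · have e : (aeval (ψ.postcomp h').coords).comp (linSubst M) = aeval ψ.coords := by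
      ext1 i
      have : (ψ.postcomp h').coords = fun i => aeval ψ.coords (linForm (N i)) := by
        ext1 i; rw [aeval_linForm]; rfl
      have e3 : aeval (ψ.postcomp h').coords = (aeval ψ.coords).comp (linSubst N) := by
        ext1 i; simp [this, linSubst]
      rw [e3, AlgHom.comp_apply, AlgHom.comp_apply, linSubst_linSubst h]
    have := DFunLike.congr_fun e (φ.coords i)
    rw [AlgHom.comp_apply] at this
    exact this.trans (hφψ i)

lemma isRelPrime_of_eval_ne_zero {p q : Form} (hp : Irreducible p) (v : Fin 3 → ℂ)
    (h0 : eval v p = 0) (h : eval v q ≠ 0) : IsRelPrime p q :=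
  hp.isRelPrime_iff_not_dvd.2 fun ⟨r, hr⟩ => h (by rw [hr, map_mul, h0, zero_mul])

lemma irreducible_linForm {c : Fin 3 → ℂ} (hc : c ≠ 0) : Irreducible (linForm c) := by
  obtain ⟨j, hj⟩ := Function.ne_iff.1 hc
  have hcoeff := coeff_single_linForm c j
  have hne : linForm c ≠ 0 := fun h => hj (by rw [← hcoeff, h, coeff_zero]; rfl)
  refine irreducible_of_totalDegree_eq_one ((isHomogeneous_linForm c).totalDegree hne)
    fun x hx => ?_
  have := hx (Finsupp.single j 1)
  rw [hcoeff] at this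
  exact isUnit_of_dvd_unit this (isUnit_iff_ne_zero.2 hj)

/-! ### The contracting map and its inverse -/

variable {ι : Type*}

/-- The product of the lines `z = a i * (x - y)`. -/
def fibers (s : Finset ι) (a : ι → ℂ) : Form := ∏ i ∈ s, (X 2 - C (a i) * (X 0 - X 1))

/-- The homogenization of `∏ (t - a i)` at `t = x * y / z ^ 2`. -/
def conics (s : Finset ι) (a : ι → ℂ) : Form := ∏ i ∈ s, (X 0 * X 1 - C (a i) * X 2 ^ 2)

lemma isHomogeneous_of_degree_eq {F : Form} {m n : ℕ} (h : F.IsHomogeneous m) (e : m = n) :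
    F.IsHomogeneous n := e ▸ h

lemma isHomogeneous_X_sub_X : (X 0 - X 1 : Form).IsHomogeneous 1 :=
  (isHomogeneous_X _ _).sub (isHomogeneous_X _ _)

lemma isHomogeneous_fibers (s : Finset ι) (a : ι → ℂ) : (fibers s a).IsHomogeneous s.card := by
  have := IsHomogeneous.prod s (fun i => (X 2 - C (a i) * (X 0 - X 1) : Form)) (fun _ => 1)
    fun i _ => (isHomogeneous_X _ _).sub (isHomogeneous_X_sub_X.C_mul _)
  rwa [Finset.sum_const, smul_eq_mul, mul_one] at this

lemma isHomogeneous_conics (s : Finset ι) (a : ι → ℂ) :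
    (conics s a).IsHomogeneous (2 * s.card) := by
  have := IsHomogeneous.prod s (fun i => (X 0 * X 1 - C (a i) * X 2 ^ 2 : Form)) (fun _ => 2)
    fun i _ => ((isHomogeneous_X _ _).mul (isHomogeneous_X _ _)).sub
      ((isHomogeneous_X_pow _ _).C_mul _)
  exact isHomogeneous_of_degree_eq this (by simp [mul_comm])

/-- With `s = x / y`, `t = z / (x - y)` and `u = s * ∏ (t - a i)`,
the rational map `(s, t) ↦ [1 : t * u ^ 2 : u]`. -/
def contraction (s : Finset ι) (a : ι → ℂ) : PlaneRationalMap where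
  degree := 2 * s.card + 3
  coords := ![X 1 ^ 2 * (X 0 - X 1) ^ (2 * s.card + 1), X 2 * X 0 ^ 2 * fibers s a ^ 2,
    X 0 * X 1 * fibers s a * (X 0 - X 1) ^ (s.card + 1)]
  isHomogeneous i := by
    have hF := isHomogeneous_fibers s a
    have hw := isHomogeneous_X_sub_X
    fin_cases i
    · exact isHomogeneous_of_degree_eq ((isHomogeneous_X_pow (R := ℂ) (1 : Fin 3) 2).mul (hw.pow (2 * s.card + 1))) (by ring)
    · exact isHomogeneous_of_degree_eq (((isHomogeneous_X ℂ (2 : Fin 3)).mul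
        (isHomogeneous_X_pow (R := ℂ) (0 : Fin 3) 2)).mul (hF.pow 2)) (by ring)
    · exact isHomogeneous_of_degree_eq ((((isHomogeneous_X ℂ (0 : Fin 3)).mul
        (isHomogeneous_X ℂ (1 : Fin 3))).mul hF).mul (hw.pow (s.card + 1))) (by ring)
  coprime := by
    refine PlaneRationalMap.coprime_of_isRelPrime (i := 0) (j := 1) ?_
    refine IsRelPrime.mul_left (IsRelPrime.pow_left ?_) (IsRelPrime.pow_left ?_)
    -- On `y = 0` the second coordinate at `[1 : 0 : t]` is `t * ∏ (t - a i) ^ 2`, so `t` must avoid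
    -- `0` and all `a i`.
    · obtain ⟨t, ht⟩ := Infinite.exists_notMem_finset (insert 0 (s.image a))
      simp only [Finset.mem_insert, Finset.mem_image, not_or, not_exists, not_and] at ht
      refine isRelPrime_of_eval_ne_zero (X_prime (i := (1 : Fin 3))).irreducible ![1, 0, t]
        (by simp) ?_
      simp [fibers, map_prod, Finset.prod_eq_zero_iff, ht.1, sub_eq_zero]
      exact fun i hi h => ht.2 i hi h.symm
    · have hw : Irreducible (X 0 - X 1 : Form) := by
        have := irreducible_linForm (c := ![1, -1, 0]) fun h => one_ne_zero (congrFun h 0)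
        simpa [linForm, Fin.sum_univ_three, ← sub_eq_add_neg] using this
      refine isRelPrime_of_eval_ne_zero hw ![1, 1, 1] (by simp) ?_
      simp [fibers, map_prod]

/-- The inverse of `contraction s a`. -/
def contractionInv (s : Finset ι) (a : ι → ℂ) : PlaneRationalMap where
  degree := 2 * s.card + 3
  coords := ![X 2 ^ (2 * s.card + 3), X 0 * conics s a * X 2 ^ 2,
    X 0 * X 1 * (X 2 ^ (2 * s.card + 1) - X 0 * conics s a)]
  isHomogeneous i := by
    have hG := isHomogeneous_conics s a
    fin_cases i
    · exact isHomogeneous_X_pow _ _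
    · exact isHomogeneous_of_degree_eq (((isHomogeneous_X ℂ (0 : Fin 3)).mul hG).mul
        (isHomogeneous_X_pow (R := ℂ) (2 : Fin 3) 2)) (by ring)
    · have h1 : (X 0 * conics s a).IsHomogeneous (2 * s.card + 1) := by
        exact isHomogeneous_of_degree_eq ((isHomogeneous_X ℂ (0 : Fin 3)).mul hG) (by ring)
      exact isHomogeneous_of_degree_eq (((isHomogeneous_X ℂ (0 : Fin 3)).mul (isHomogeneous_X ℂ (1 : Fin 3))).mul
        ((isHomogeneous_X_pow (R := ℂ) (2 : Fin 3) (2 * s.card + 1)).sub h1)) (by ring)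
  coprime := by
    refine PlaneRationalMap.coprime_of_isRelPrime (i := 0) (j := 2) (IsRelPrime.pow_left ?_)
    refine isRelPrime_of_eval_ne_zero (X_prime (i := (2 : Fin 3))).irreducible ![1, 1, 0]
      (by simp) ?_
    simp [conics, map_prod]

lemma aeval_fibers {A : Type*} [CommRing A] [Algebra ℂ A] (f : Fin 3 → A) (s : Finset ι)
    (a : ι → ℂ) : aeval f (fibers s a)
      = ∏ i ∈ s, (f 2 - algebraMap ℂ A (a i) * (f 0 - f 1)) := by
  simp only [fibers, map_prod, map_sub, map_mul, aeval_X, algHom_C]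

lemma aeval_conics {A : Type*} [CommRing A] [Algebra ℂ A] (f : Fin 3 → A) (s : Finset ι)
    (a : ι → ℂ) : aeval f (conics s a)
      = ∏ i ∈ s, (f 0 * f 1 - algebraMap ℂ A (a i) * f 2 ^ 2) := by
  simp only [conics, map_prod, map_sub, map_mul, map_pow, aeval_X, algHom_C]

lemma fibers_ne_zero (s : Finset ι) (a : ι → ℂ) : fibers s a ≠ 0 := by
  intro h
  have : eval ![1, 1, 1] (fibers s a) = 0 := by rw [h, map_zero]
  simp [fibers, map_prod] at this

lemma conics_ne_zero (s : Finset ι) (a : ι → ℂ) : conics s a ≠ 0 := by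
  intro h
  have : eval ![1, 1, 0] (conics s a) = 0 := by rw [h, map_zero]
  simp [conics, map_prod] at this

lemma X_sub_X_ne_zero : (X 0 - X 1 : Form) ≠ 0 := by
  intro h
  have : eval ![1, 0, 0] (X 0 - X 1 : Form) = 0 := by rw [h, map_zero]
  simp at this

lemma contractionInv_isLeftInverse (s : Finset ι) (a : ι → ℂ) :
    (contractionInv s a).IsLeftInverse (contraction s a) := by
  set F := fibers s a with hF
  set n := s.card with hn
  have hG : aeval (contraction s a).coords (conics s a)
      = (X 0 ^ 2 * X 1 ^ 2 * F ^ 2 * (X 0 - X 1) ^ (2 * n + 1)) ^ n * F := by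
    rw [aeval_conics, hF, hn, fibers, ← Finset.prod_const, ← Finset.prod_mul_distrib]
    refine Finset.prod_congr rfl fun i _ => ?_
    simp only [contraction, Matrix.cons_val, algebraMap_eq, fibers]
    ring
  obtain ⟨w, hw⟩ : ∃ w : Form, w = X 0 - X 1 := ⟨_, rfl⟩
  have hw0 : w ≠ 0 := hw ▸ X_sub_X_ne_zero
  have hF0 : F ≠ 0 := fibers_ne_zero s a
  rw [← hw] at hG
  -- `K` is what `hx` and `hy` leave after splitting off `X 0` and `X 1`; the common factor of the
  -- composite is `K` times the square of the third coordinate.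
  set K := X 0 ^ (2 * n) * X 1 ^ (2 * n + 1) * F ^ (2 * n + 1) * w ^ ((2 * n + 1) * (n + 1))
    with hK
  have hx : (X 0 * X 1 * F * w ^ (n + 1)) ^ (2 * n + 1) = K * X 0 := by rw [hK]; ring
  have hy : X 1 ^ 2 * w ^ (2 * n + 1) * ((X 0 ^ 2 * X 1 ^ 2 * F ^ 2 * w ^ (2 * n + 1)) ^ n * F)
      = K * X 1 := by rw [hK]; ring
  refine ⟨K * (X 0 * X 1 * F * w ^ (n + 1)) ^ 2, by simp [hK, hF0, hw0], fun i => ?_⟩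
  fin_cases i
  · simp only [contractionInv, Matrix.cons_val, map_pow, aeval_X, Fin.zero_eta, ← hn]
    simp only [contraction, Matrix.cons_val, ← hF, ← hn, ← hw]
    rw [show 2 * n + 3 = (2 * n + 1) + 2 from rfl, pow_add, hx]
    ring
  · simp only [contractionInv, Matrix.cons_val, map_pow, map_mul, aeval_X, Fin.mk_one, hG]
    simp only [contraction, Matrix.cons_val, ← hF, ← hn, ← hw]
    rw [hy]
    ring
  · simp only [contractionInv, Matrix.cons_val, map_pow, map_mul, map_sub, aeval_X,
      Fin.reduceFinMk, hG, ← hn]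
    simp only [contraction, Matrix.cons_val, ← hF, ← hn, ← hw]
    rw [hy, hx, ← mul_sub, ← hw]
    ring

lemma contraction_isLeftInverse (s : Finset ι) (a : ι → ℂ) :
    (contraction s a).IsLeftInverse (contractionInv s a) := by
  set G := conics s a with hG
  set n := s.card with hn
  set D := X 2 ^ (2 * n + 1) - X 0 * G with hD
  -- The difference of the first two coordinates of the inverse, to be substituted for `X 0 - X 1`.
  have hw : X 2 ^ (2 * n + 3) - X 0 * G * X 2 ^ 2 = X 2 ^ 2 * D := by rw [hD]; ring
  have hD0 : D ≠ 0 := by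
    intro h
    have : eval ![1, 1, 0] D = 0 := by rw [h, map_zero]
    simp [hD, hG, conics, map_prod] at this
  have hF : aeval (contractionInv s a).coords (fibers s a) = D ^ n * G := by
    rw [aeval_fibers, hG, hn, conics, ← Finset.prod_const, ← Finset.prod_mul_distrib]
    refine Finset.prod_congr rfl fun i _ => ?_
    simp only [contractionInv, Matrix.cons_val, algebraMap_eq, ← hG, ← hn, hw, ← hD]
    ring
  -- Read off from the first coordinate, `(X 0 * G * X 2 ^ 2) ^ 2 * (X 2 ^ 2 * D) ^ (2 * n + 1)`, by
  -- removing one `X 0`.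
  refine ⟨X 0 * G ^ 2 * X 2 ^ (4 * n + 6) * D ^ (2 * n + 1), ?_, fun i => ?_⟩
  · simp [hG, conics_ne_zero s a, hD0]
  clear_value D
  fin_cases i
  · simp only [contraction, Matrix.cons_val, map_pow, map_mul, map_sub, aeval_X, Fin.zero_eta,
      ← hn]
    simp only [contractionInv, Matrix.cons_val, ← hG, ← hn, hw]
    ring
  · simp only [contraction, Matrix.cons_val, map_pow, map_mul, aeval_X, Fin.mk_one, hF]
    simp only [contractionInv, Matrix.cons_val, ← hG, ← hn, ← hD]
    ring
  · simp only [contraction, Matrix.cons_val, map_pow, map_mul, map_sub, aeval_X,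
      Fin.reduceFinMk, hF, ← hn]
    simp only [contractionInv, Matrix.cons_val, ← hG, ← hn, hw]
    ring

lemma contraction_isCremona (s : Finset ι) (a : ι → ℂ) : (contraction s a).IsCremona :=
  ⟨contractionInv s a, contractionInv_isLeftInverse s a, contraction_isLeftInverse s a⟩

/-! ### The contracted lines -/

/-- A rational map is constant on a curve if its values there have a single nonzero coordinate. -/
lemma PlaneRationalMap.isConstantOn_of_forall_coord_eq_zero (φ : PlaneRationalMap) (g : Form)
    (k : Fin 3) (h : ∀ v, eval v g = 0 → ∀ j ≠ k, eval v (φ.coords j) = 0) :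
    φ.IsConstantOn g := by
  refine ⟨Projectivization.mk ℂ (Pi.single k 1) (by simp), fun p hp hne => ?_⟩
  rw [Projectivization.mk_eq_mk_iff']
  refine ⟨φ.evalAt p.rep k, ?_⟩
  ext j
  by_cases hj : j = k
  · subst hj; simp
  · simp [hj, PlaneRationalMap.evalAt, h _ hp j hj]

lemma exists_coord_contraction_eq_zero (s : Finset ι) (a : ι → ℂ) (l : Form)
    (hl : l = X 0 ∨ l = X 1 ∨ ∃ i ∈ s, l = X 2 - C (a i) * (X 0 - X 1)) :
    ∃ k, ∀ j ≠ k, l ∣ (contraction s a).coords j := by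
  have aux : l ∣ X 0 * fibers s a → ∀ j ≠ 0, l ∣ (contraction s a).coords j := by
    intro h j hj
    fin_cases j
    · exact absurd rfl hj
    · refine h.trans ⟨X 2 * X 0 * fibers s a, ?_⟩
      simp only [contraction, Matrix.cons_val, Fin.mk_one]
      ring
    · refine h.trans ⟨X 1 * (X 0 - X 1) ^ (s.card + 1), ?_⟩
      simp only [contraction, Matrix.cons_val, Fin.reduceFinMk]
      ring
  obtain rfl | rfl | ⟨i, hi, rfl⟩ := hl
  · exact ⟨0, aux (dvd_mul_right _ _)⟩
  · refine ⟨1, fun j hj => ?_⟩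
    fin_cases j
    · exact ⟨X 1 * (X 0 - X 1) ^ (2 * s.card + 1), by
        simp only [contraction, Matrix.cons_val, Fin.zero_eta]; ring⟩
    · exact absurd rfl hj
    · exact ⟨X 0 * fibers s a * (X 0 - X 1) ^ (s.card + 1), by
        simp only [contraction, Matrix.cons_val, Fin.reduceFinMk]; ring⟩
  · exact ⟨0, aux ((Finset.dvd_prod_of_mem
      (fun i => (X 2 - C (a i) * (X 0 - X 1) : Form)) hi).mul_left _)⟩

lemma isConstantOn_precomp_contraction {ι : Type*} (s : Finset ι) (a : ι → ℂ)
    {M N : Matrix (Fin 3) (Fin 3) ℂ} (h : M * N = 1) (l g : Form)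
    (hl : l = X 0 ∨ l = X 1 ∨ ∃ i ∈ s, l = X 2 - C (a i) * (X 0 - X 1))
    (hg : g ∣ linSubst M l) : ((contraction s a).precomp h).IsConstantOn g := by
  obtain ⟨k, hk⟩ := exists_coord_contraction_eq_zero s a l hl
  refine PlaneRationalMap.isConstantOn_of_forall_coord_eq_zero _ _ k fun v hv j hj => ?_
  obtain ⟨r, hr⟩ : g ∣ linSubst M ((contraction s a).coords j) :=
    hg.trans (map_dvd (linSubst M) (hk j hj))
  change eval v (linSubst M ((contraction s a).coords j)) = 0
  rw [hr, map_mul, hv, zero_mul]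

/-! ### Normal form of the configuration -/

/-- The points `p` and `q = u ⨯₃ v` differ, as `u` vanishes only at `q`; so `q ⨯₃ p` has a nonzero
entry `k`, and `z = p ⨯₃ e_k` works. -/
lemma exists_dotProduct_eq_zero_and_ne_zero {u v p : Fin 3 → ℂ} (huv : u ⨯₃ v ≠ 0)
    (hu : u ⬝ᵥ p ≠ 0) : ∃ z : Fin 3 → ℂ, z ⬝ᵥ p = 0 ∧ z ⬝ᵥ (u ⨯₃ v) ≠ 0 := by
  have hqp : (u ⨯₃ v) ⨯₃ p ≠ 0 := by
    intro h
    have h1 : u ⨯₃ ((u ⨯₃ v) ⨯₃ p) = (u ⬝ᵥ p) • (u ⨯₃ v) := by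
      ext i
      fin_cases i <;> simp [cross_apply, dotProduct, Fin.sum_univ_three] <;> ring
    rw [h, map_zero] at h1
    exact (smul_ne_zero hu huv) h1.symm
  obtain ⟨k, hk⟩ := Function.ne_iff.1 hqp
  refine ⟨p ⨯₃ Pi.single k 1, ?_, ?_⟩
  · rw [dotProduct_comm, dot_self_cross]
  · rw [dotProduct_comm, triple_product_permutation, triple_product_permutation]
    simpa using hk

/-- Two distinct lines not through a point `p` and finitely many lines through `p`, but not through
the intersection of the first two, are contracted by a common Cremona transformation. -/
lemma exists_isCremona_isConstantOn {ι : Type*} (s : Finset ι) (c : ι → Fin 3 → ℂ)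
    (u v p : Fin 3 → ℂ) (huv : u ⨯₃ v ≠ 0) (hu : u ⬝ᵥ p ≠ 0) (hv : v ⬝ᵥ p ≠ 0)
    (hp : ∀ i ∈ s, c i ⬝ᵥ p = 0) (hq : ∀ i ∈ s, c i ⬝ᵥ (u ⨯₃ v) ≠ 0) :
    ∃ φ : PlaneRationalMap, φ.IsCremona ∧ φ.IsConstantOn (linForm u) ∧
      φ.IsConstantOn (linForm v) ∧ ∀ i ∈ s, φ.IsConstantOn (linForm (c i)) := by
  obtain ⟨z, hzp, hzq⟩ := exists_dotProduct_eq_zero_and_ne_zero huv hu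
  -- Scaling makes `x` and `y` both `1` at `p`, so that `x - y` vanishes there.
  set x := (u ⬝ᵥ p)⁻¹ • u with hx
  set y := (v ⬝ᵥ p)⁻¹ • v with hy
  have hxp : x ⬝ᵥ p = 1 := by rw [hx, smul_dotProduct, smul_eq_mul, inv_mul_cancel₀ hu]
  have hyp : y ⬝ᵥ p = 1 := by rw [hy, smul_dotProduct, smul_eq_mul, inv_mul_cancel₀ hv]
  have hxq : x ⬝ᵥ (u ⨯₃ v) = 0 := by rw [hx, smul_dotProduct, dot_self_cross, smul_zero]
  have hyq : y ⬝ᵥ (u ⨯₃ v) = 0 := by rw [hy, smul_dotProduct, dot_cross_self, smul_zero]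
  set M : Matrix (Fin 3) (Fin 3) ℂ := Matrix.of ![x, y, z] with hM
  have hdet : IsUnit M.det := by
    have h1 : M.det = (u ⬝ᵥ p)⁻¹ * ((v ⬝ᵥ p)⁻¹ * (z ⬝ᵥ (u ⨯₃ v))) := by
      have : M.det = x ⬝ᵥ (y ⨯₃ z) := (triple_product_eq_det x y z).symm
      rw [this, triple_product_permutation, triple_product_permutation, hx, hy]
      simp [dotProduct_smul, mul_left_comm]
    rw [h1]
    exact isUnit_iff_ne_zero.2 (mul_ne_zero (inv_ne_zero hu) (mul_ne_zero (inv_ne_zero hv) hzq))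
  have h : M * M⁻¹ = 1 := Matrix.mul_nonsing_inv M hdet
  obtain ⟨w, hw⟩ : ∃ w : ι → Fin 3 → ℂ, ∀ i, c i = w i 0 • x + w i 1 • y + w i 2 • z := by
    refine ⟨fun i => c i ᵥ* M⁻¹, fun i => ?_⟩
    have h1 : (c i ᵥ* M⁻¹) ᵥ* M = c i := by
      rw [Matrix.vecMul_vecMul, Matrix.nonsing_inv_mul M hdet, Matrix.vecMul_one]
    conv_lhs => rw [← h1]
    ext j
    simp [Matrix.vecMul, dotProduct, Fin.sum_univ_three, hM]
  have hsum : ∀ i ∈ s, w i 1 = - w i 0 := by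
    intro i hi
    have := hp i hi
    rw [hw i] at this
    simp only [add_dotProduct, smul_dotProduct, hxp, hyp, hzp, smul_eq_mul] at this
    linear_combination this
  have hne : ∀ i ∈ s, w i 2 ≠ 0 := by
    intro i hi h0
    apply hq i hi
    rw [hw i]
    simp only [add_dotProduct, smul_dotProduct, hxq, hyq, h0, smul_eq_mul]
    ring
  have hl : ∀ i, linForm (M i) = linSubst M (X i) := fun i => by rw [linSubst, aeval_X]
  -- By `hsum`, `c i = w i 0 • (x - y) + w i 2 • z`; solving for `z` gives the parameter.
  refine ⟨(contraction s fun i => -(w i 0 / w i 2)).precomp h,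
    (contraction_isCremona _ _).precomp h, ?_, ?_, fun i hi => ?_⟩
  · refine isConstantOn_precomp_contraction _ _ h (X 0) _ (Or.inl rfl) ?_
    rw [← hl]
    change _ ∣ linForm x
    rw [hx, linForm_smul]
    exact dvd_mul_left _ _
  · refine isConstantOn_precomp_contraction _ _ h (X 1) _ (Or.inr (Or.inl rfl)) ?_
    rw [← hl]
    change _ ∣ linForm y
    rw [hy, linForm_smul]
    exact dvd_mul_left _ _
  · refine isConstantOn_precomp_contraction _ _ h _ _ (Or.inr (Or.inr ⟨i, hi, rfl⟩)) ?_
    have e : X 2 - C (-(w i 0 / w i 2)) * (X 0 - X 1)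
        = linForm ![w i 0 / w i 2, -(w i 0 / w i 2), 1] := by
      simp [linForm, Fin.sum_univ_three]
      ring
    have e2 : ![w i 0 / w i 2, -(w i 0 / w i 2), 1] ᵥ* M = (w i 2)⁻¹ • c i := by
      conv_rhs => rw [hw i, hsum i hi]
      have := hne i hi
      ext j
      simp [Matrix.vecMul, dotProduct, Fin.sum_univ_three, hM]
      field_simp
    rw [e, linSubst_linForm, e2, linForm_smul]
    exact dvd_mul_left _ _

/-! ### Reading the configuration off the type -/

theorem PlaneCurve.IsUnionOfLinesOfType.isCrContractible {d : ℕ} (hd : 2 ≤ d) {C : PlaneCurve}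
    (hC : C.IsUnionOfLinesOfType d ((d - 2) :: List.replicate (2 * d - 3) 2)) :
    C.IsCrContractible := by
  classical
  obtain ⟨⟨L, hL, hform⟩, hdeg, P, -, hPm, hPo⟩ := hC
  choose c hc using fun i => exists_eq_linForm (hL i)
  obtain rfl : L = fun i => linForm (c i) := funext hc
  have hsq := C.squarefree
  rw [hform] at hsq
  have hc0 : ∀ i, c i ≠ 0 := by
    intro i hi
    refine hsq.ne_zero (Finset.prod_eq_zero (Finset.mem_univ i) ?_)
    simp [linForm, hi]
  have hmult : ∀ Q, C.multiplicity Q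
      = ((Finset.univ.filter fun i => c i ⬝ᵥ Q.rep = 0).card : ℕ∞) := by
    intro Q
    rw [PlaneCurve.multiplicity, hform, orderAt_prod_linForm _ fun i _ => hc0 i]
  have hle : ∀ Q, Q ≠ P 0 → (Finset.univ.filter fun i => c i ⬝ᵥ Q.rep = 0).card ≤ 2 := by
    intro Q hQ
    have : C.multiplicity Q ≤ 2 := by
      by_cases h : Q ∈ Set.range P
      · obtain ⟨k, rfl⟩ := h
        obtain ⟨k, rfl⟩ := Fin.exists_succ_eq.2 (fun h : k = 0 => hQ (by rw [h]))
        rw [hPm]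
        simp
      · exact (hPo Q h).trans one_le_two
    rw [hmult] at this
    exact_mod_cast this
  have hP0 : (Finset.univ.filter fun i => c i ⬝ᵥ (P 0).rep = 0).card = d - 2 := by
    have := hPm 0
    rw [hmult] at this
    exact Nat.cast_injective this
  have h2 : (Finset.univ.filter fun i => ¬ c i ⬝ᵥ (P 0).rep = 0).card = 2 := by
    have := Finset.card_filter_add_card_filter_not (s := Finset.univ)
      (fun i => c i ⬝ᵥ (P 0).rep = 0)
    rw [hP0, Finset.card_univ, Fintype.card_fin] at this
    omega
  obtain ⟨a, b, hab, hset⟩ := Finset.card_eq_two.1 h2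
  have hmem : ∀ i, c i ⬝ᵥ (P 0).rep ≠ 0 ↔ i = a ∨ i = b := by
    intro i
    simpa using Finset.ext_iff.1 hset i
  -- Proportional coefficient vectors would put a square into the squarefree equation.
  have hcross : c a ⨯₃ c b ≠ 0 := by
    rw [crossProduct_ne_zero_iff_linearIndependent, LinearIndependent.pair_iff' (hc0 a)]
    rintro t ht
    have h1 : linForm (c a) * linForm (c a) ∣ ∏ i, linForm (c i) := by
      rw [← Finset.mul_prod_erase _ _ (Finset.mem_univ a),
        ← Finset.mul_prod_erase _ _ (Finset.mem_erase.2 ⟨hab.symm, Finset.mem_univ b⟩),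
        ← ht, linForm_smul]
      exact mul_dvd_mul_left _ ((dvd_mul_left _ _).mul_right _)
    exact (irreducible_linForm (hc0 a)).not_isUnit (hsq _ h1)
  obtain ⟨φ, hφ, h_a, h_b, h_s⟩ := exists_isCremona_isConstantOn
    (Finset.univ.filter fun i => c i ⬝ᵥ (P 0).rep = 0) c (c a) (c b) (P 0).rep hcross
    ((hmem a).2 (Or.inl rfl)) ((hmem b).2 (Or.inr rfl)) (by simp) (by
      intro i hi h0
      rw [Finset.mem_filter] at hi
      set Q : Plane := Projectivization.mk ℂ _ hcross with hQ
      obtain ⟨t, ht⟩ := Projectivization.exists_smul_eq_mk_rep ℂ _ hcross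
      have hz : ∀ w : Fin 3 → ℂ, w ⬝ᵥ (c a ⨯₃ c b) = 0 → w ⬝ᵥ Q.rep = 0 := by
        intro w hw
        rw [hQ, ← ht, dotProduct_smul, hw, smul_zero]
      have hQa := hz _ (dot_self_cross (c a) (c b))
      have hQb := hz _ (dot_cross_self (c a) (c b))
      have hne : Q ≠ P 0 := fun h => (hmem a).2 (Or.inl rfl) (h ▸ hQa)
      have hi' : i ≠ a ∧ i ≠ b := by
        rw [← not_or, ← hmem]
        exact not_not.2 hi.2
      -- A third line through `Q` would give multiplicity at least `3` away from `P 0`.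
      have hsub : ({i, a, b} : Finset _) ⊆ Finset.univ.filter fun i => c i ⬝ᵥ Q.rep = 0 := by
        intro j hj
        simp only [Finset.mem_insert, Finset.mem_singleton] at hj
        rcases hj with rfl | rfl | rfl <;> simp [hQa, hQb, hz _ h0]
      have := (Finset.card_le_card hsub).trans (hle Q hne)
      rw [Finset.card_eq_three.2 ⟨i, a, b, hi'.1, hi'.2, hab, rfl⟩] at this
      omega)
  have hall : ∀ i, φ.IsConstantOn (linForm (c i)) := by
    intro i
    by_cases hi : c i ⬝ᵥ (P 0).rep = 0
    · exact h_s i (by simp [hi])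
    · rcases (hmem i).1 hi with rfl | rfl
      exacts [h_a, h_b]
  refine ⟨φ, hφ, fun g hg hgC => ?_⟩
  rw [hform] at hgC
  obtain ⟨i, -, hi⟩ := (hg.prime.dvd_finsetProd_iff _).1 hgC
  obtain ⟨q, hq⟩ := hall i
  refine ⟨q, fun p hp => hq p ?_⟩
  obtain ⟨r, hr⟩ := hi
  rw [show linForm (c i) = g * r from hr, map_mul, hp, zero_mul]

end PlaneCremona

end

theorem mainTheorem3 (d : ℕ) (hd : 2 ≤ d) (C : PlaneCremona.PlaneCurve)
    (hC : C.IsUnionOfLinesOfType d ((d - 2) :: List.replicate (2 * d - 3) 2)) :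
    C.IsCrContractible :=
  hC.isCrContractible hd
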